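/- Let $\mathbb T^3=(\mathbb R/2\pi\mathbb Z)^3$, let $3<p<5$, $s>\frac{p-3}{p-1}$ and let $\delta>0$ be so small that $s-\delta>\frac{p-3}{p-1}$. Write $s-:=s-\delta$, and for $a\in\mathbb R$ let $\langle\nabla\rangle^{a}$ be the Fourier multiplier with symbol $(1+|n|^2)^{a/2}$, $n\in\mathbb Z^3$. For a real-valued $v$ with time derivative $\partial_t v$ (at a fixed time), put $$E(v)=\int_{\mathbb T^3}\Big(\tfrac12|\partial_t v|^2+\tfrac12|\nabla v|^2+\tfrac1{p+1}|v|^{p+1}\Big)\,dx .$$ Then there is a constant $C>0$ depending only on $p$, $s$ and $\delta$ such that for all real-valued functions $v\in L^{p+1}(\mathbb T^3)$ with weak gradient $\nabla v\in L^2(\mathbb T^3)$, all $\partial_t v\in L^2(\mathbb T^3)$, and all real-valued integrable functions $\tilde z$ with $\langle\nabla\rangle^{s-}\tilde z\in L^\infty(\mathbb T^3)$ and $\langle\nabla\rangle\tilde z\in L^{p+1}(\mathbb T^3)$, $$\Big|\int_{\mathbb T^3}|v|^{p-1}v\,\langle\nabla\rangle\tilde z\,dx\Big|\le C\Big[\big(\|\langle\nabla\rangle^{s-}\tilde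 z\|_{L^\infty}+1\big)E(v)+\|\langle\nabla\rangle^{s-}\tilde z\|_{L^\infty}^{p+1}\Big].$$ In particular this applies, at each time $t$, to $v(t)$, $\partial_tv(t)$ for any finite-energy solution $v$ of a nonlinear wave equation on $\mathbb T^3$ and to any real trigonometric polynomial $\tilde z(t)$. -/

import Mathlib

open MeasureTheory
open scoped ENNReal

noncomputable section

namespace WaveTorus

/-- The torus `T³ = (ℝ/2πℤ)³`. A point `x` is recorded by `θ ∈ (ℝ/ℤ)³` through `x = 2πθ`. In this
parametrisation the character `x ↦ exp (i n·x)` is `UnitAddTorus.mFourier n`. All derivatives and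
integrals below are taken with respect to `x`, not `θ`. -/
abbrev T3 : Type := UnitAddTorus (Fin 3)

/-- The measure `dθ = (2π)⁻³ dx` on the torus, normalised to total mass one. -/
abbrev haar : Measure T3 := Measure.pi fun _ => AddCircle.haarAddCircle

/-- The integral `∫_{T³} f(x) dx` with respect to Lebesgue measure `dx = (2π)³ dθ`. -/
def integral (f : T3 → ℝ) : ℝ := (2 * Real.pi) ^ 3 * ∫ θ, f θ ∂haar

/-- The Fourier coefficient `(2π)⁻³ ∫_{T³} f(x) exp (-i n·x) dx` of a real function. -/
def coeff (f : T3 → ℝ) (n : Fin 3 → ℤ) : ℂ :=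
  ∫ θ, UnitAddTorus.mFourier (-n) θ * (f θ : ℂ) ∂haar

/-- The Japanese bracket `⟨n⟩ = (1 + |n|²)^{1/2}` of a frequency `n ∈ ℤ³`. -/
def bracket (n : Fin 3 → ℤ) : ℝ := Real.sqrt (1 + ∑ i, (n i : ℝ) ^ 2)

/-- `g` is the Bessel derivative `⟨∇⟩^a f`: both are integrable functions on the torus and
`g` is obtained from `f` by the Fourier multiplier `⟨n⟩^a`. This determines `g` almost everywhere. -/
structure IsBessel (a : ℝ) (f g : T3 → ℝ) : Prop where
  integrable_left : Integrable f haar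
  integrable_right : Integrable g haar
  coeff_eq : ∀ n, coeff g n = ((bracket n ^ a : ℝ) : ℂ) * coeff f n

/-- `g = (g₀, g₁, g₂)` is the weak gradient `∇v` on the torus: all functions are integrable
and `∫ gᵢ φ dx = - ∫ v ∂ᵢφ dx` for every character `φ(x) = exp (-i n·x)`, where
`∂ᵢφ = -i nᵢ φ`. The characters span a dense subspace of the smooth functions on the torus, so this
is the usual weak gradient. -/
structure IsWeakGradient (v : T3 → ℝ) (g : Fin 3 → T3 → ℝ) : Prop where
  integrable_left : Integrable v haar
  integrable_right : ∀ i, Integrable (g i) haar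
  coeff_eq : ∀ i n, coeff (g i) n = Complex.I * (n i : ℂ) * coeff v n

/-- The state `(v, ∂ₜv)`, with `∇v = gradv`, has finite energy: `v ∈ L^{p+1}`, `∂ₜv ∈ L²`, and the
weak gradient of `v` is `gradv ∈ L²`. -/
structure FiniteEnergy (p : ℝ) (v vt : T3 → ℝ) (gradv : Fin 3 → T3 → ℝ) : Prop where
  memLp : MemLp v (ENNReal.ofReal (p + 1)) haar
  memLp_dt : MemLp vt 2 haar
  isWeakGradient : IsWeakGradient v gradv
  memLp_grad : ∀ i, MemLp (gradv i) 2 haar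

/-- The nonlinear energy
`E(v) = ∫_{T³} ( |∂ₜv|²/2 + |∇v|²/2 + |v|^{p+1}/(p+1) ) dx` of the equation
`∂ₜ²v - Δv + |v|^{p-1} v = 0`, as a function of the state `(v, ∂ₜv)` and of `∇v`. -/
def energy (p : ℝ) (v vt : T3 → ℝ) (gradv : Fin 3 → T3 → ℝ) : ℝ :=
  integral fun θ =>
    vt θ ^ 2 / 2 + (∑ i, gradv i θ ^ 2) / 2 + |v θ| ^ (p + 1) / (p + 1)

/-- The norm of `L^∞(T³)`. -/
def normLinf (f : T3 → ℝ) : ℝ := (eLpNorm f ∞ haar).toReal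

end WaveTorus

end

/-! Duality is made pointwise by correlations. With f = |v|^{p-1} v, let J and H be the correlations
of f with ⟨∇⟩^{s-} z̃ and with ⟨∇⟩ z̃. The integral to be bounded is (2π)³ H(0), and on the Fourier
side H = ⟨∇⟩^α J with α = 1 - (s - δ). So it suffices to bound ⟨∇⟩^α J uniformly.

Let N be the sup norm of ⟨∇⟩^{s-} z̃ and β = 2/(p-1). By translation invariance, increments of J
fall on f (`abs_corr_sub_le`), so J is bounded by N‖f‖₁ and inherits the L¹ modulus of continuity of
f. That modulus is E(v)|h|^β up to a constant (`FiniteEnergy.integral_abs_sub_translate_le`): a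
pointwise interpolation between |v|^{p+1} and the squared increment of v, whose L² norm is
controlled by ∇v through Parseval.

The hypothesis on s says exactly α < β, and ⟨∇⟩^α maps bounded β-Hölder functions to bounded
functions (`exists_bound_of_bessel`). For α > 0 this comes from writing ⟨n⟩^α as a multiple of ∫₀^∞
(1 - e^{-t⟨n⟩²}) t^{-1-α/2} dt, where e^{-t⟨n⟩²} is the symbol of e^{-t} times a Gaussian average of
translations; for α < 0 a Gamma integral replaces it. Young's inequality absorbs the remaining term
N‖f‖₁. -/

namespace WaveTorus

open UnitAddTorus ProbabilityTheory

/-! ### Characters, Parseval and translations -/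

/-- The image in the torus of a vector of `ℝ³`. -/
def proj (h : Fin 3 → ℝ) : T3 := fun i => (h i : UnitAddCircle)

lemma measurable_proj : Measurable proj :=
  measurable_pi_lambda _ fun i => AddCircle.measurable_mk'.comp (measurable_pi_apply i)

lemma mFourier_proj (n : Fin 3 → ℤ) (h : Fin 3 → ℝ) :
    mFourier n (proj h) = Complex.exp ((2 * Real.pi * ∑ i, (n i : ℝ) * h i : ℝ) * Complex.I) := by
  simp only [mFourier, proj, ContinuousMap.coe_mk, fourier_coe_apply]
  rw [← Complex.exp_sum]
  congr 1
  push_cast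
  simp only [Finset.mul_sum, Finset.sum_mul]
  refine Finset.sum_congr rfl fun i _ => ?_
  ring_nf

lemma norm_mFourier_apply (n : Fin 3 → ℤ) (x : T3) : ‖mFourier n x‖ = 1 := by
  simp only [mFourier, fourier_apply, ContinuousMap.coe_mk, norm_prod, Circle.norm_coe,
    Finset.prod_const_one]

lemma mFourier_add_apply (n : Fin 3 → ℤ) (x y : T3) :
    mFourier n (x + y) = mFourier n x * mFourier n y := by
  simp only [mFourier, ContinuousMap.coe_mk, ← Finset.prod_mul_distrib]
  refine Finset.prod_congr rfl fun i _ => ?_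
  simp only [fourier_apply, Pi.add_apply, smul_add, AddCircle.toCircle_add, Circle.coe_mul]

lemma mFourier_neg_apply (n : Fin 3 → ℤ) (x : T3) : mFourier n (-x) = mFourier (-n) x := by
  simp only [mFourier, ContinuousMap.coe_mk, fourier_apply, Pi.neg_apply, smul_neg, neg_smul]

lemma norm_one_sub_mFourier_proj_le (n : Fin 3 → ℤ) (h : Fin 3 → ℝ) :
    ‖1 - mFourier n (proj h)‖ ≤ 2 * Real.pi * |∑ i, (n i : ℝ) * h i| := by
  rw [mFourier_proj, norm_sub_rev, mul_comm _ Complex.I]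
  refine (Real.norm_exp_I_mul_ofReal_sub_one_le).trans (le_of_eq ?_)
  rw [Real.norm_eq_abs, abs_mul, abs_of_pos Real.two_pi_pos]

lemma sq_sum_mul_le (n h : Fin 3 → ℝ) :
    (∑ i, n i * h i) ^ 2 ≤ 3 * ‖h‖ ^ 2 * ∑ i, n i ^ 2 := by
  refine (Finset.sum_mul_sq_le_sq_mul_sq _ _ _).trans ?_
  rw [mul_comm]
  gcongr
  calc ∑ i, h i ^ 2 ≤ ∑ _i : Fin 3, ‖h‖ ^ 2 := by
        refine Finset.sum_le_sum fun i _ => ?_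
        rw [← sq_abs, ← Real.norm_eq_abs]
        exact pow_le_pow_left₀ (norm_nonneg _) (norm_le_pi_norm h i) 2
    _ = 3 * ‖h‖ ^ 2 := by simp

/-- Parseval's identity. -/
lemma hasSum_sq_coeff {f : T3 → ℝ} (hf : MemLp f 2 haar) :
    HasSum (fun n => ‖coeff f n‖ ^ 2) (∫ θ, f θ ^ 2 ∂haar) := by
  have hF : MemLp (fun θ => (f θ : ℂ)) 2 haar := hf.ofReal
  have key := UnitAddTorus.hasSum_sq_mFourierCoeff (d := Fin 3) (hF.toLp _)
  have e1 : ∀ n, mFourierCoeff (hF.toLp _ : T3 → ℂ) n = coeff f n := fun n => by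
    refine integral_congr_ae ?_
    filter_upwards [hF.coeFn_toLp] with θ hθ
    rw [hθ, smul_eq_mul]
  have e2 : (∫ θ, ‖(hF.toLp _ : T3 → ℂ) θ‖ ^ 2 ∂haar) = ∫ θ, f θ ^ 2 ∂haar := by
    refine integral_congr_ae ?_
    filter_upwards [hF.coeFn_toLp] with θ hθ
    rw [hθ]; simp
  simp only [e1] at key
  rw [← e2]
  exact key

lemma integrable_mFourier_mul {f : T3 → ℝ} (hf : Integrable f haar) (n : Fin 3 → ℤ) :
    Integrable (fun θ => mFourier n θ * (f θ : ℂ)) haar :=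
  hf.ofReal.bdd_mul (c := 1) (mFourier n).continuous.aestronglyMeasurable
    (.of_forall fun θ => (norm_mFourier_apply n θ).le)

lemma coeff_sub {f g : T3 → ℝ} (hf : Integrable f haar) (hg : Integrable g haar) (n : Fin 3 → ℤ) :
    coeff (fun θ => f θ - g θ) n = coeff f n - coeff g n := by
  simp only [coeff, Complex.ofReal_sub, mul_sub]
  exact integral_sub (integrable_mFourier_mul hf _) (integrable_mFourier_mul hg _)

lemma coeff_comp_sub (f : T3 → ℝ) (y : T3) (n : Fin 3 → ℤ) :
    coeff (fun θ => f (θ - y)) n = mFourier (-n) y * coeff f n := by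
  simp only [coeff]
  rw [← integral_add_right_eq_self _ y, ← integral_const_mul]
  refine integral_congr_ae (.of_forall fun θ => ?_)
  simp only [add_sub_cancel_right, mFourier_add_apply]
  ring

/-- A square integrable function is determined almost everywhere by its Fourier coefficients. -/
lemma ae_eq_of_coeff_eq {f g : T3 → ℝ} (hf : MemLp f 2 haar) (hg : MemLp g 2 haar)
    (h : ∀ n, coeff f n = coeff g n) : f =ᵐ[haar] g := by
  have hp := hasSum_sq_coeff (hf.sub hg)
  have h0 : ∀ n, coeff (f - g) n = 0 := fun n => by
    have := coeff_sub (hf.integrable one_le_two) (hg.integrable one_le_two) n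
    rw [h n, sub_self] at this
    exact this
  simp only [h0, norm_zero, ne_eq, OfNat.ofNat_ne_zero, not_false_eq_true, zero_pow] at hp
  have hz := hp.unique hasSum_zero
  rw [integral_eq_zero_iff_of_nonneg (fun θ => sq_nonneg _) (hf.sub hg).integrable_sq] at hz
  filter_upwards [hz] with θ hθ
  simpa [sub_eq_zero] using hθ

lemma measurePreserving_sub (y : T3) : MeasurePreserving (fun θ : T3 => θ - y) haar haar := by
  simpa [sub_eq_add_neg] using measurePreserving_add_right haar (-y)

/-- The `L²` modulus of continuity is controlled by the weak gradient. -/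
lemma integral_sq_sub_translate_le {v : T3 → ℝ} {g : Fin 3 → T3 → ℝ} (hv : MemLp v 2 haar)
    (hw : IsWeakGradient v g) (hg : ∀ i, MemLp (g i) 2 haar) (h : Fin 3 → ℝ) :
    ∫ θ, (v θ - v (θ - proj h)) ^ 2 ∂haar
      ≤ 12 * Real.pi ^ 2 * ‖h‖ ^ 2 * ∫ θ, ∑ i, g i θ ^ 2 ∂haar := by
  have hv' : MemLp (fun θ => v (θ - proj h)) 2 haar :=
    hv.comp_measurePreserving (measurePreserving_sub _)
  have h1 := hasSum_sq_coeff (hv.sub hv')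
  have h2 : HasSum (fun n => 12 * Real.pi ^ 2 * ‖h‖ ^ 2 * ∑ i, ‖coeff (g i) n‖ ^ 2)
      (12 * Real.pi ^ 2 * ‖h‖ ^ 2 * ∫ θ, ∑ i, g i θ ^ 2 ∂haar) := by
    rw [integral_finsetSum _ fun i _ => (hg i).integrable_sq]
    exact (hasSum_sum fun i _ => hasSum_sq_coeff (hg i)).mul_left _
  refine hasSum_le (fun n => ?_) h1 h2
  have e1 : coeff (v - fun θ => v (θ - proj h)) n
      = (1 - mFourier (-n) (proj h)) * coeff v n := by
    rw [sub_mul, one_mul, ← coeff_comp_sub]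
    exact coeff_sub (hv.integrable one_le_two) (hv'.integrable one_le_two) n
  have e2 : ∑ i, ‖coeff (g i) n‖ ^ 2 = (∑ i, ((-n) i : ℝ) ^ 2) * ‖coeff v n‖ ^ 2 := by
    rw [Finset.sum_mul]
    refine Finset.sum_congr rfl fun i _ => ?_
    rw [hw.coeff_eq]
    simp [mul_pow]
  rw [e1, e2, norm_mul, mul_pow, ← mul_assoc]
  gcongr
  -- The constant 12π² is (2π)² · 3: the 2π comes from x = 2πθ, the 3 from measuring h in the sup
  -- norm of ℝ³.
  calc ‖1 - mFourier (-n) (proj h)‖ ^ 2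
      ≤ (2 * Real.pi * |∑ i, ((-n) i : ℝ) * h i|) ^ 2 :=
        pow_le_pow_left₀ (norm_nonneg _) (by simpa using norm_one_sub_mFourier_proj_le (-n) h) 2
    _ = 4 * Real.pi ^ 2 * (∑ i, ((-n) i : ℝ) * h i) ^ 2 := by rw [mul_pow, sq_abs]; ring
    _ ≤ 4 * Real.pi ^ 2 * (3 * ‖h‖ ^ 2 * ∑ i, ((-n) i : ℝ) ^ 2) := by
        gcongr; exact sq_sum_mul_le (fun i => ((-n) i : ℝ)) h
    _ = _ := by ring

/-! ### Correlations on the torus -/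

instance : Measure.IsNegInvariant haar :=
  Measure.IsAddHaarMeasure.isNegInvariant_of_regular haar

/-- The correlation `y ↦ ∫ f(θ) g(θ - y) dθ` of two functions on the torus. -/
noncomputable def corr (f g : T3 → ℝ) (y : T3) : ℝ := ∫ θ, f θ * g (θ - y) ∂haar

/-- Translations act strongly continuously on `Lp` for finite exponents, and pairing with f is a
continuous functional. Continuity is what gives the value at the single point 0 a meaning in terms
of Fourier coefficients. -/
lemma continuous_corr {f g : T3 → ℝ} {P Q : ℝ≥0∞} [hPQ : P.HolderConjugate Q] (hQ : Q ≠ ∞)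
    (hf : MemLp f P haar) (hg : MemLp g Q haar) : Continuous (corr f g) := by
  have : Fact (1 ≤ Q) := ⟨ENNReal.HolderConjugate.one_le Q P⟩
  have : Fact (1 ≤ P) := ⟨ENNReal.HolderConjugate.one_le P Q⟩
  have : Fact (Q ≠ ∞) := ⟨hQ⟩
  have : ContinuousVAdd T3ᵈᵃᵃ (Lp ℝ Q haar) := by apply @Lp.instContinuousVAddDomAddAct
  let B := (ContinuousLinearMap.mul ℝ ℝ).lpPairing haar P Q
  have hcont : Continuous fun y : T3 => B (hf.toLp f) (DomAddAct.mk (-y) +ᵥ hg.toLp g) := by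
    refine (B (hf.toLp f)).continuous.comp ?_
    have h1 : Continuous fun y : T3 => DomAddAct.mk (-y) :=
      DomAddAct.continuous_mk.comp continuous_neg
    exact h1.vadd continuous_const
  refine hcont.congr fun y => ?_
  rw [ContinuousLinearMap.lpPairing_eq_integral]
  refine integral_congr_ae ?_
  filter_upwards [hf.coeFn_toLp, DomAddAct.vadd_Lp_ae_eq (DomAddAct.mk (-y)) (hg.toLp g),
    (measurePreserving_sub y).quasiMeasurePreserving.ae hg.coeFn_toLp] with θ h1 h2 h3
  rw [h1, h2]
  simp only [Equiv.symm_apply_apply, vadd_eq_add, ContinuousLinearMap.mul_apply']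
  rw [neg_add_eq_sub, h3]

/-- Fubini. The frequency -n, due to correlating rather than convolving, is harmless later because
`bracket` is even. -/
lemma coeff_corr {f g : T3 → ℝ} (hf : Integrable f haar) (hg : Integrable g haar)
    (n : Fin 3 → ℤ) : coeff (corr f g) n = coeff f n * coeff g (-n) := by
  have hint : Integrable (Function.uncurry fun (y θ : T3) =>
      mFourier (-n) y * ((f θ * g (θ - y) : ℝ) : ℂ)) (haar.prod haar) := by
    have h1 : Integrable (fun q : T3 × T3 => f q.2 * g (q.1 - q.2)) (haar.prod haar) :=
      hf.convolution_integrand (ContinuousLinearMap.mul ℝ ℝ) hg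
    have h2 : Integrable (fun q : T3 × T3 => f q.2 * g (q.2 - q.1)) (haar.prod haar) := by
      have hneg : Integrable (fun θ => g (-θ)) haar :=
        (Measure.measurePreserving_neg haar).integrable_comp_of_integrable hg
      have := hf.convolution_integrand (ContinuousLinearMap.mul ℝ ℝ) hneg (μ := haar)
      simpa using this
    refine h2.ofReal.bdd_mul (c := 1) (f := fun q : T3 × T3 => mFourier (-n) q.1)
      ((mFourier (-n)).continuous.comp continuous_fst).aestronglyMeasurable
      (.of_forall fun q => (norm_mFourier_apply _ _).le)
  calc coeff (corr f g) n
      = ∫ y, ∫ θ, mFourier (-n) y * ((f θ * g (θ - y) : ℝ) : ℂ) ∂haar ∂haar := by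
        refine integral_congr_ae (.of_forall fun y => ?_)
        simp only [corr]
        rw [integral_const_mul, integral_complex_ofReal]
    _ = ∫ θ, ∫ y, mFourier (-n) y * ((f θ * g (θ - y) : ℝ) : ℂ) ∂haar ∂haar :=
        integral_integral_swap hint
    _ = ∫ θ, mFourier (-n) θ * (f θ : ℂ) * coeff g (-n) ∂haar := by
        refine integral_congr_ae (.of_forall fun θ => ?_)
        simp only [coeff]
        -- The substitution y ↦ θ - y separates the character into a factor in θ and a factor in y.
        rw [← integral_const_mul, ← integral_sub_left_eq_self _ haar θ]
        refine integral_congr_ae (.of_forall fun y => ?_)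
        beta_reduce
        rw [sub_sub_cancel, sub_eq_add_neg, mFourier_add_apply, mFourier_neg_apply]
        push_cast
        ring
    _ = coeff f n * coeff g (-n) := integral_mul_const _ _

lemma abs_corr_le {f w : T3 → ℝ} {A : ℝ} (hf : Integrable f haar) (hw : ∀ᵐ θ ∂haar, |w θ| ≤ A)
    (y : T3) : |corr f w y| ≤ A * ∫ θ, |f θ| ∂haar := by
  rw [← integral_const_mul]
  refine norm_integral_le_of_norm_le (f := fun θ => f θ * w (θ - y)) (hf.abs.const_mul A) ?_
  filter_upwards [(measurePreserving_sub y).quasiMeasurePreserving.ae hw] with θ h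
  rw [norm_mul, mul_comm, Real.norm_eq_abs, Real.norm_eq_abs]
  gcongr

/-- Translation invariance of the measure moves the increment in y onto f, so w need only be bounded
and all regularity comes from f. -/
lemma abs_corr_sub_le {f w : T3 → ℝ} {A : ℝ} (hf : Integrable f haar)
    (hwm : AEStronglyMeasurable w haar) (hw : ∀ᵐ θ ∂haar, |w θ| ≤ A) (y h : T3) :
    |corr f w y - corr f w (y - h)| ≤ A * ∫ θ, |f θ - f (θ - h)| ∂haar := by
  have hf' : Integrable (fun θ => f (θ - h)) haar :=
    (measurePreserving_sub h).integrable_comp_of_integrable hf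
  have hint : ∀ {u : T3 → ℝ}, Integrable u haar →
      Integrable (fun θ => u θ * w (θ - y)) haar := fun hu =>
    hu.mul_bdd (c := A) (hwm.comp_measurePreserving (measurePreserving_sub y))
      ((measurePreserving_sub y).quasiMeasurePreserving.ae hw)
  have e : corr f w (y - h) = ∫ θ, f (θ - h) * w (θ - y) ∂haar := by
    simp only [corr]
    rw [← integral_sub_right_eq_self _ h]
    refine integral_congr_ae (.of_forall fun θ => ?_)
    simp only [sub_sub_sub_cancel_right]
  have e2 : corr f w y - corr f w (y - h) = corr (fun θ => f θ - f (θ - h)) w y := by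
    rw [e]
    simp only [corr, sub_mul]
    exact (integral_sub (hint hf) (hint hf')).symm
  rw [e2]
  exact abs_corr_le (hf.sub hf') hw y

/-! ### Multipliers as averages of translations -/

/-- A Fourier multiplier which is an average of the operators `J ↦ a J - b J(· - Y)` is bounded on
a function `J` as soon as these averages converge absolutely. -/
lemma abs_le_of_multiplier {Ω : Type*} [MeasurableSpace Ω] {ν : Measure Ω} [SFinite ν]
    {a b F : Ω → ℝ} {Y : Ω → T3} (ha : Measurable a) (hb : Measurable b) (hY : Measurable Y)
    (hFm : Measurable F) (hF : Integrable F ν) {J H : T3 → ℝ} (hJ : Continuous J) (hH : Continuous H)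
    (hJF : ∀ y, ∀ᵐ ω ∂ν, |a ω * J y - b ω * J (y - Y ω)| ≤ F ω)
    (hcoeff : ∀ n, coeff H n
      = (∫ ω, ((a ω : ℂ) - (b ω : ℂ) * mFourier (-n) (Y ω)) ∂ν) * coeff J n) (y : T3) :
    |H y| ≤ ∫ ω, F ω ∂ν := by
  set G : T3 → Ω → ℝ := fun y ω => a ω * J y - b ω * J (y - Y ω) with hG
  have hGm : Measurable (Function.uncurry G) := by
    have h1 := hJ.measurable
    have h2 : Measurable fun q : T3 × Ω => q.1 - Y q.2 :=
      measurable_fst.sub (hY.comp measurable_snd)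
    exact ((ha.comp measurable_snd).mul (h1.comp measurable_fst)).sub
      ((hb.comp measurable_snd).mul (h1.comp h2))
  have hGi : Integrable (Function.uncurry G) (haar.prod ν) := by
    have hF2 : Integrable (fun q : T3 × Ω => F q.2) (haar.prod ν) := hF.comp_snd haar
    refine hF2.mono' hGm.aestronglyMeasurable ?_
    exact (Measure.ae_prod_iff_ae_ae (measurableSet_le hGm.norm
      (hFm.comp measurable_snd))).mpr (.of_forall hJF)
  set S : T3 → ℝ := fun y => ∫ ω, G y ω ∂ν with hS
  have hSb : ∀ y, |S y| ≤ ∫ ω, F ω ∂ν := fun y => norm_integral_le_of_norm_le (f := G y) hF (hJF y)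
  have hSi : Integrable S haar := hGi.integral_prod_left
  have hS2 : MemLp S 2 haar := .of_bound hSi.aestronglyMeasurable _ (.of_forall hSb)
  have hH2 : MemLp H 2 haar := by
    obtain ⟨K, hK⟩ := isCompact_univ.exists_bound_of_continuousOn hH.continuousOn
    exact .of_bound hH.aestronglyMeasurable K (.of_forall fun y => hK y (Set.mem_univ y))
  have hJi : Integrable J haar := by
    obtain ⟨K, hK⟩ := isCompact_univ.exists_bound_of_continuousOn hJ.continuousOn
    exact .of_bound hJ.aestronglyMeasurable K (.of_forall fun y => hK y (Set.mem_univ y))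
  have hJi' : ∀ z, Integrable (fun θ => J (θ - z)) haar := fun z =>
    (measurePreserving_sub z).integrable_comp_of_integrable hJi
  have hae : H =ᵐ[haar] S := by
    refine ae_eq_of_coeff_eq hH2 hS2 fun n => ?_
    have hint : Integrable (Function.uncurry fun (y : T3) (ω : Ω) =>
        mFourier (-n) y * (G y ω : ℂ)) (haar.prod ν) :=
      hGi.ofReal.bdd_mul (c := 1) (f := fun q : T3 × Ω => mFourier (-n) q.1)
        (((mFourier (-n)).continuous.measurable.comp measurable_fst).aestronglyMeasurable)
        (.of_forall fun q => (norm_mFourier_apply _ _).le)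
    symm
    calc coeff S n = ∫ y, ∫ ω, mFourier (-n) y * (G y ω : ℂ) ∂ν ∂haar := by
          refine integral_congr_ae (.of_forall fun y => ?_)
          simp only [hS]
          rw [integral_const_mul, integral_complex_ofReal]
      _ = ∫ ω, ∫ y, mFourier (-n) y * (G y ω : ℂ) ∂haar ∂ν := integral_integral_swap hint
      _ = ∫ ω, ((a ω : ℂ) - (b ω : ℂ) * mFourier (-n) (Y ω)) * coeff J n ∂ν := by
          refine integral_congr_ae (.of_forall fun ω => ?_)
          simp only
          rw [sub_mul, mul_assoc, ← coeff_comp_sub]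
          simp only [coeff]
          rw [← integral_const_mul, ← integral_const_mul, ← integral_sub
            ((integrable_mFourier_mul hJi _).const_mul _)
            ((integrable_mFourier_mul (hJi' _) _).const_mul _)]
          refine integral_congr_ae (.of_forall fun y => ?_)
          simp only [hG]
          push_cast
          ring
      _ = coeff H n := by rw [integral_mul_const, hcoeff]
  -- Equality of coefficients identifies H with the average only almost everywhere; a closed set of
  -- full measure is everything.
  have hcl : IsClosed {y | |H y| ≤ ∫ ω, F ω ∂ν} := isClosed_le hH.abs continuous_const
  have hd : Dense {y | |H y| ≤ ∫ ω, F ω ∂ν} := by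
    refine Measure.dense_of_ae (μ := haar) ?_
    filter_upwards [hae] with y hy
    rw [hy]
    exact hSb y
  exact (hcl.closure_eq ▸ hd y : y ∈ {y | |H y| ≤ ∫ ω, F ω ∂ν})

/-! ### Gaussian displacements and heat increments -/

/-- The standard Gaussian measure on `ℝ³`. -/
noncomputable abbrev gauss : Measure (Fin 3 → ℝ) := Measure.pi fun _ => gaussianReal 0 1

lemma integrable_norm_gauss : Integrable (fun g : Fin 3 → ℝ => ‖g‖) gauss := by
  have h1 : ∀ i : Fin 3, Integrable (fun g : Fin 3 → ℝ => |g i|) gauss := fun i => by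
    have h := (memLp_one_iff_integrable.mp (memLp_id_gaussianReal (μ := 0) (v := 1) 1)).abs
    exact integrable_comp_eval (μ := fun _ : Fin 3 => gaussianReal 0 1) (i := i) h
  refine (integrable_finsetSum Finset.univ fun i _ => h1 i).mono'
    continuous_norm.aestronglyMeasurable (.of_forall fun g => ?_)
  rw [norm_norm]
  refine (pi_norm_le_iff_of_nonneg (Finset.sum_nonneg fun i _ => abs_nonneg _)).mpr fun i => ?_
  exact Finset.single_le_sum (f := fun i => |g i|) (fun i _ => abs_nonneg _) (Finset.mem_univ i)

/-- The Brownian displacement at time `t` (for the generator `Δ`) as a point of the torus. -/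
noncomputable def displacement (q : ℝ × (Fin 3 → ℝ)) : T3 :=
  proj ((Real.sqrt (2 * q.1) / (2 * Real.pi)) • q.2)

lemma measurable_displacement : Measurable displacement :=
  measurable_proj.comp (by fun_prop)

/-- The Gaussian characteristic function, one coordinate at a time: the variance is 2t in the
variable x, and the 2π of the character cancels the one in `displacement`. -/
lemma integral_mFourier_displacement {t : ℝ} (ht : 0 ≤ t) (n : Fin 3 → ℤ) :
    ∫ g, mFourier n (displacement (t, g)) ∂gauss
      = ((Real.exp (-(t * ∑ i, (n i : ℝ) ^ 2)) : ℝ) : ℂ) := by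
  have h1 : ∀ g : Fin 3 → ℝ, mFourier n (displacement (t, g))
      = ∏ i, Complex.exp (((Real.sqrt (2 * t) * n i : ℝ) : ℂ) * (g i : ℂ) * Complex.I) := by
    intro g
    rw [displacement, mFourier_proj, ← Complex.exp_sum]
    congr 1
    rw [Finset.mul_sum, Complex.ofReal_sum, Finset.sum_mul]
    refine Finset.sum_congr rfl fun i _ => ?_
    congr 1
    rw [← Complex.ofReal_mul]
    congr 1
    simp only [Pi.smul_apply, smul_eq_mul]
    have := Real.pi_ne_zero
    field_simp
  simp only [h1]
  rw [integral_fintype_prod_eq_prod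
    (f := fun i (x : ℝ) => Complex.exp (((Real.sqrt (2 * t) * n i : ℝ) : ℂ) * (x : ℂ) * Complex.I))]
  simp only [← charFun_apply_real, charFun_gaussianReal]
  rw [← Complex.exp_sum, Complex.ofReal_exp]
  congr 1
  rw [Finset.mul_sum, ← Finset.sum_neg_distrib, Complex.ofReal_sum]
  refine Finset.sum_congr rfl fun i _ => ?_
  have : ((Real.sqrt (2 * t) * n i : ℝ) : ℂ) ^ 2 = ((2 * t * n i ^ 2 : ℝ) : ℂ) := by
    rw [← Complex.ofReal_pow, mul_pow, Real.sq_sqrt (by positivity)]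
  rw [this]
  push_cast
  ring

/-- The function `min(1, t^{β/2}) t^{-1-α/2}` is integrable on `(0, ∞)` for `0 < α < β`. -/
lemma integrableOn_min_rpow {α β : ℝ} (hα : 0 < α) (hαβ : α < β) :
    IntegrableOn (fun t : ℝ => min 1 (t ^ (β / 2)) * t ^ (-1 - α / 2)) (Set.Ioi 0) := by
  have hm : Measurable fun t : ℝ => min 1 (t ^ (β / 2)) * t ^ (-1 - α / 2) := by fun_prop
  rw [← Set.Ioc_union_Ioi_eq_Ioi zero_le_one]
  refine IntegrableOn.union ?_ ?_
  · have h : IntegrableOn (fun t : ℝ => t ^ (β / 2 - 1 - α / 2)) (Set.Ioc 0 1) := by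
      rw [← intervalIntegrable_iff_integrableOn_Ioc_of_le zero_le_one]
      exact intervalIntegral.intervalIntegrable_rpow' (by linarith)
    refine h.mono' hm.aestronglyMeasurable ?_
    filter_upwards [ae_restrict_mem measurableSet_Ioc] with t ht
    have h0 := ht.1
    rw [Real.norm_of_nonneg (by positivity)]
    calc _ ≤ t ^ (β / 2) * t ^ (-1 - α / 2) := by gcongr; exact min_le_right _ _
      _ = _ := by rw [← Real.rpow_add h0]; ring_nf
  · have h : IntegrableOn (fun t : ℝ => t ^ (-1 - α / 2)) (Set.Ioi 1) :=
      integrableOn_Ioi_rpow_of_lt (by linarith) one_pos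
    refine h.mono' hm.aestronglyMeasurable ?_
    filter_upwards [ae_restrict_mem measurableSet_Ioi] with t ht
    have h0 : (0:ℝ) < t := one_pos.trans ht
    rw [Real.norm_of_nonneg (by positivity)]
    calc _ ≤ 1 * t ^ (-1 - α / 2) := by gcongr; exact min_le_left _ _
      _ = _ := one_mul _

/-- The measure `dt × gauss` on `(0, ∞) × ℝ³`. -/
noncomputable abbrev heatMeasure : Measure (ℝ × (Fin 3 → ℝ)) :=
  (volume.restrict (Set.Ioi 0)).prod gauss

lemma ae_heatMeasure_pos : ∀ᵐ q ∂heatMeasure, 0 < q.1 :=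
  Measure.quasiMeasurePreserving_fst.ae (ae_restrict_mem measurableSet_Ioi)

lemma integrable_dominant {α β : ℝ} (hα : 0 < α) (hαβ : α < β) :
    Integrable (fun q : ℝ × (Fin 3 → ℝ) =>
      min 1 (q.1 ^ (β / 2)) * q.1 ^ (-1 - α / 2) * (1 + ‖q.2‖)) heatMeasure :=
  (integrableOn_min_rpow hα hαβ).mul_prod ((integrable_const 1).add integrable_norm_gauss)

/-- Bounded Hölder functions have small heat increments. -/
lemma norm_sub_exp_smul_displacement_le {E : Type*} [NormedAddCommGroup E] [NormedSpace ℝ E]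
    {φ : T3 → E} {M β : ℝ} (hβ : 0 < β) (hβ1 : β ≤ 1) (hM : ∀ y, ‖φ y‖ ≤ M)
    (hφ : ∀ y h, ‖φ y - φ (y - proj h)‖ ≤ M * ‖h‖ ^ β) (y : T3) {t : ℝ} (ht : 0 < t)
    (g : Fin 3 → ℝ) :
    ‖φ y - Real.exp (-t) • φ (y - displacement (t, g))‖
      ≤ 3 * M * (min 1 (t ^ (β / 2)) * (1 + ‖g‖)) := by
  have hM0 : 0 ≤ M := (norm_nonneg _).trans (hM y)
  have hg := norm_nonneg g
  have he : Real.exp (-t) ≤ 1 := Real.exp_le_one_iff.mpr (by linarith)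
  have he' : 1 - t ≤ Real.exp (-t) := by linarith [Real.add_one_le_exp (-t)]
  have hsmall : ‖φ y - Real.exp (-t) • φ (y - displacement (t, g))‖ ≤ 2 * M := by
    calc _ ≤ ‖φ y‖ + ‖Real.exp (-t) • φ (y - displacement (t, g))‖ := norm_sub_le _ _
      _ ≤ M + 1 * M := by
          rw [norm_smul, Real.norm_of_nonneg (Real.exp_pos _).le]
          gcongr <;> exact hM _
      _ = 2 * M := by ring
  rcases le_total 1 t with h1 | h1
  · have hmin : min 1 (t ^ (β / 2)) = 1 := min_eq_left (Real.one_le_rpow h1 (by linarith))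
    rw [hmin, one_mul]
    nlinarith [mul_nonneg hM0 hg]
  · have hmin : min 1 (t ^ (β / 2)) = t ^ (β / 2) :=
      min_eq_right (Real.rpow_le_one ht.le h1 (by linarith))
    have htb : t ≤ t ^ (β / 2) := by
      conv_lhs => rw [← Real.rpow_one t]
      exact Real.rpow_le_rpow_of_exponent_ge ht h1 (by linarith)
    -- Since β ≤ 1, the growth in g is at most linear, so a first Gaussian moment will suffice.
    have hdis : ‖φ y - φ (y - displacement (t, g))‖ ≤ M * (t ^ (β / 2) * (1 + ‖g‖)) := by
      refine (hφ y _).trans ?_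
      gcongr
      have hc : Real.sqrt (2 * t) / (2 * Real.pi) ≤ Real.sqrt t := by
        rw [div_le_iff₀ Real.two_pi_pos, Real.sqrt_mul (by norm_num), mul_comm]
        gcongr
        have : Real.sqrt 2 ≤ 2 := Real.sqrt_le_iff.mpr (by norm_num)
        linarith [Real.pi_gt_three]
      rw [norm_smul, Real.norm_of_nonneg (by positivity)]
      calc (Real.sqrt (2 * t) / (2 * Real.pi) * ‖g‖) ^ β
          ≤ (Real.sqrt t * (1 + ‖g‖)) ^ β := by gcongr; linarith
        _ = t ^ (β / 2) * (1 + ‖g‖) ^ β := by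
            rw [Real.mul_rpow (by positivity) (by positivity), Real.sqrt_eq_rpow,
              ← Real.rpow_mul ht.le]
            congr 2; ring
        _ ≤ t ^ (β / 2) * (1 + ‖g‖) := by
            gcongr
            conv_rhs => rw [← Real.rpow_one (1 + ‖g‖)]
            exact Real.rpow_le_rpow_of_exponent_le (by linarith) hβ1
    -- The damping factor costs 1 - e^{-t} ≤ t, which is at most t^{β/2} for t ≤ 1.
    have hsplit : φ y - Real.exp (-t) • φ (y - displacement (t, g))
        = (φ y - φ (y - displacement (t, g)))
          + (1 - Real.exp (-t)) • φ (y - displacement (t, g)) := by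
      rw [sub_smul, one_smul]; abel
    rw [hsplit, hmin]
    calc _ ≤ M * (t ^ (β / 2) * (1 + ‖g‖)) + t ^ (β / 2) * M := by
          refine (norm_add_le _ _).trans (add_le_add hdis ?_)
          rw [norm_smul, Real.norm_of_nonneg (by linarith)]
          gcongr
          · linarith
          · exact hM _
      _ ≤ _ := by
          have : 0 ≤ t ^ (β / 2) := by positivity
          nlinarith [mul_nonneg this hM0, mul_nonneg (mul_nonneg this hM0) hg]

/-- This puts characters under the heat increment bound with β = 1, which makes the integral for the
symbol converge absolutely. The summand 1 lets the same constant bound the sup norm. -/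
lemma norm_mFourier_sub_translate_le (n : Fin 3 → ℤ) (y : T3) (h : Fin 3 → ℝ) :
    ‖mFourier n y - mFourier n (y - proj h)‖
      ≤ (1 + 2 * Real.pi * ∑ i, |(n i : ℝ)|) * ‖h‖ ^ (1 : ℝ) := by
  have e : mFourier n y - mFourier n (y - proj h)
      = mFourier n (y - proj h) * (mFourier n (proj h) - 1) := by
    rw [mul_sub, ← mFourier_add_apply, sub_add_cancel, mul_one]
  rw [e, norm_mul, norm_mFourier_apply, one_mul, norm_sub_rev, Real.rpow_one]
  refine (norm_one_sub_mFourier_proj_le n h).trans ?_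
  have : |∑ i, (n i : ℝ) * h i| ≤ (∑ i, |(n i : ℝ)|) * ‖h‖ := by
    rw [Finset.sum_mul]
    refine (Finset.abs_sum_le_sum_abs _ _).trans (Finset.sum_le_sum fun i _ => ?_)
    rw [abs_mul]
    gcongr
    exact norm_le_pi_norm h i
  have hpi := Real.pi_pos
  calc _ ≤ 2 * Real.pi * ((∑ i, |(n i : ℝ)|) * ‖h‖) := by gcongr
    _ ≤ _ := by nlinarith [norm_nonneg h]

/-! ### Powers of the bracket by subordination -/

/-- The normalising constant `∫₀^∞ (1 - e^{-t}) t^{-1-α/2} dt`. -/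
noncomputable def fracConst (α : ℝ) : ℝ :=
  ∫ t in Set.Ioi (0 : ℝ), (1 - Real.exp (-t)) * t ^ (-1 - α / 2)

/-- Since 1 - e^{-t} ≤ min(1, t), this is the case β = 2 of `integrableOn_min_rpow`. -/
lemma integrableOn_fracConst {α : ℝ} (hα : 0 < α) (hα1 : α < 2) :
    IntegrableOn (fun t : ℝ => (1 - Real.exp (-t)) * t ^ (-1 - α / 2)) (Set.Ioi 0) := by
  refine (integrableOn_min_rpow hα hα1).mono' (by fun_prop) ?_
  filter_upwards [ae_restrict_mem measurableSet_Ioi] with t ht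
  have ht : (0:ℝ) < t := ht
  have h1 : Real.exp (-t) ≤ 1 := Real.exp_le_one_iff.mpr (by linarith)
  have h2 := Real.add_one_le_exp (-t)
  rw [Real.norm_of_nonneg (mul_nonneg (by linarith) (by positivity))]
  gcongr
  refine le_min (by linarith [Real.exp_pos (-t)]) ?_
  norm_num
  linarith

lemma fracConst_pos {α : ℝ} (hα : 0 < α) (hα1 : α < 2) : 0 < fracConst α := by
  have h : ∀ t ∈ Set.Ioi (0:ℝ), 0 < (1 - Real.exp (-t)) * t ^ (-1 - α / 2) := fun t ht => by
    have ht : (0:ℝ) < t := ht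
    have h1 : Real.exp (-t) < 1 := by rw [Real.exp_lt_one_iff]; linarith
    exact mul_pos (by linarith) (by positivity)
  rw [fracConst, setIntegral_pos_iff_support_of_nonneg_ae
    ((ae_restrict_mem measurableSet_Ioi).mono fun t ht => (h t ht).le)
    (integrableOn_fracConst hα hα1)]
  have : Set.Ioi (0:ℝ) ⊆ Function.support
      (fun t : ℝ => (1 - Real.exp (-t)) * t ^ (-1 - α / 2)) ∩ Set.Ioi 0 :=
    fun t ht => ⟨(h t ht).ne', ht⟩
  exact lt_of_lt_of_le (by simp) (measure_mono this)

/-- Scaling t by r. With r = ⟨n⟩² this is the subordination formula for ⟨n⟩^α. -/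
lemma integral_one_sub_exp_mul_rpow {α r : ℝ} (hr : 0 < r) :
    ∫ t in Set.Ioi (0 : ℝ), (1 - Real.exp (-(t * r))) * t ^ (-1 - α / 2)
      = fracConst α * r ^ (α / 2) := by
  have h := integral_comp_mul_left_Ioi
    (fun t : ℝ => (1 - Real.exp (-t)) * t ^ (-1 - α / 2)) 0 hr
  rw [mul_zero, smul_eq_mul] at h
  have h2 : ∫ t in Set.Ioi (0 : ℝ), (1 - Real.exp (-(r * t))) * (r * t) ^ (-1 - α / 2)
      = r ^ (-1 - α / 2) *
        ∫ t in Set.Ioi (0 : ℝ), (1 - Real.exp (-(t * r))) * t ^ (-1 - α / 2) := by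
    rw [← integral_const_mul]
    refine setIntegral_congr_fun measurableSet_Ioi fun t ht => ?_
    rw [Real.mul_rpow hr.le (le_of_lt ht), mul_comm r t]
    ring
  rw [h2] at h
  have hpos : 0 < r ^ (-1 - α / 2) := by positivity
  have e : r⁻¹ = r ^ (-1 - α / 2) * r ^ (α / 2) := by
    rw [← Real.rpow_add hr, ← Real.rpow_neg_one]; ring_nf
  rw [e] at h
  refine mul_left_cancel₀ hpos.ne' ?_
  rw [h, fracConst]
  ring

lemma bracket_sq (n : Fin 3 → ℤ) : bracket n ^ 2 = 1 + ∑ i, (n i : ℝ) ^ 2 :=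
  Real.sq_sqrt (by positivity)

lemma bracket_pos (n : Fin 3 → ℤ) : 0 < bracket n := Real.sqrt_pos.mpr (by positivity)

lemma rpow_bracket_sq (n : Fin 3 → ℤ) (α : ℝ) :
    (1 + ∑ i, (n i : ℝ) ^ 2) ^ (α / 2) = bracket n ^ α := by
  rw [← bracket_sq, ← Real.rpow_natCast, ← Real.rpow_mul (bracket_pos n).le]
  congr 1
  push_cast
  ring

lemma exp_mul_integral_mFourier_displacement {t : ℝ} (ht : 0 ≤ t) (n : Fin 3 → ℤ) :
    (Real.exp (-t) : ℂ) * ∫ g, mFourier (-n) (displacement (t, g)) ∂gauss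
      = ((Real.exp (-(t * (1 + ∑ i, (n i : ℝ) ^ 2))) : ℝ) : ℂ) := by
  rw [integral_mFourier_displacement ht, ← Complex.ofReal_mul, ← Real.exp_add]
  congr 2
  simp only [Pi.neg_apply, Int.cast_neg, neg_sq]
  ring

/-- `⟨∇⟩^α` with `0 < α < β` maps bounded `β`-Hölder functions to bounded functions. -/
lemma exists_bound_of_bessel_pos {α β : ℝ} (hα : 0 < α) (hαβ : α < β) (hβ : β ≤ 1) :
    ∃ C : ℝ, 0 ≤ C ∧ ∀ (J H : T3 → ℝ) (M : ℝ), Continuous J → Continuous H → (∀ y, |J y| ≤ M) →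
      (∀ y h, |J y - J (y - proj h)| ≤ M * ‖h‖ ^ β) →
      (∀ n, coeff H n = ((bracket n ^ α : ℝ) : ℂ) * coeff J n) → ∀ y, |H y| ≤ C * M := by
  have hc := fracConst_pos hα (by linarith)
  set c := fracConst α with hcdef
  set D : ℝ × (Fin 3 → ℝ) → ℝ := fun q =>
    min 1 (q.1 ^ (β / 2)) * q.1 ^ (-1 - α / 2) * (1 + ‖q.2‖) with hD
  have hDpos : 0 ≤ ∫ q, D q ∂heatMeasure := by
    refine integral_nonneg_of_ae ?_
    filter_upwards [ae_heatMeasure_pos] with q hq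
    simp only [hD, Pi.zero_apply]
    positivity
  refine ⟨c⁻¹ * 3 * ∫ q, D q ∂heatMeasure, by positivity, fun J H M hJ hH hM hJh hcoeff y => ?_⟩
  -- The two terms must stay together: t^{-1-α/2} is not integrable at 0, and only their
  -- cancellation gives convergence.
  have hmul : ∀ n : Fin 3 → ℤ, ∫ q : ℝ × (Fin 3 → ℝ), (((c⁻¹ * q.1 ^ (-1 - α / 2) : ℝ) : ℂ)
      - ((c⁻¹ * q.1 ^ (-1 - α / 2) * Real.exp (-q.1) : ℝ) : ℂ) * mFourier (-n) (displacement q))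
        ∂heatMeasure = ((bracket n ^ α : ℝ) : ℂ) := by
    intro n
    have hint : Integrable (fun q : ℝ × (Fin 3 → ℝ) => (((c⁻¹ * q.1 ^ (-1 - α / 2) : ℝ) : ℂ)
      - ((c⁻¹ * q.1 ^ (-1 - α / 2) * Real.exp (-q.1) : ℝ) : ℂ)
        * mFourier (-n) (displacement q))) heatMeasure := by
      set K := 1 + 2 * Real.pi * ∑ i, |(n i : ℝ)| with hK
      have hpi := Real.pi_pos
      refine ((integrable_dominant hα (by linarith : α < 1)).const_mul (c⁻¹ * (3 * K))).mono' ?_ ?_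
      · have h1 := (mFourier (-n)).continuous.measurable.comp measurable_displacement
        refine Measurable.aestronglyMeasurable (Measurable.sub ?_ (Measurable.mul ?_ h1))
        · exact Complex.measurable_ofReal.comp (by fun_prop)
        · exact Complex.measurable_ofReal.comp (by fun_prop)
      · filter_upwards [ae_heatMeasure_pos] with q hq
        have key := norm_sub_exp_smul_displacement_le (φ := mFourier n) (M := K) one_pos le_rfl
          (fun y => by
            rw [norm_mFourier_apply]
            have : 0 ≤ ∑ i, |(n i : ℝ)| := Finset.sum_nonneg fun i _ => abs_nonneg _
            nlinarith) (norm_mFourier_sub_translate_le n) 0 hq q.2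
        have e0 : mFourier n (0 : T3) = 1 := by
          simp [mFourier]
        rw [e0, zero_sub, mFourier_neg_apply] at key
        have e1 : (((c⁻¹ * q.1 ^ (-1 - α / 2) : ℝ) : ℂ)
            - ((c⁻¹ * q.1 ^ (-1 - α / 2) * Real.exp (-q.1) : ℝ) : ℂ)
              * mFourier (-n) (displacement q))
            = ((c⁻¹ * q.1 ^ (-1 - α / 2) : ℝ) : ℂ)
              * (1 - Real.exp (-q.1) • mFourier (-n) (displacement (q.1, q.2))) := by
          rw [Complex.real_smul]
          push_cast
          ring
        rw [e1, norm_mul, Complex.norm_real, Real.norm_of_nonneg (by positivity)]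
        calc _ ≤ _ := mul_le_mul_of_nonneg_left key (by positivity)
          _ = _ := by ring
    rw [integral_prod _ hint]
    calc _ = ∫ t in Set.Ioi (0 : ℝ), ((c⁻¹ * ((1 - Real.exp (-(t * (1 + ∑ i, (n i : ℝ) ^ 2))))
          * t ^ (-1 - α / 2)) : ℝ) : ℂ) := by
          refine setIntegral_congr_fun measurableSet_Ioi fun t ht => ?_
          have ht : (0:ℝ) < t := ht
          have hi : Integrable (fun g => mFourier (-n) (displacement (t, g))) gauss := by
            refine .of_bound (C := 1) ?_ (.of_forall fun g => (norm_mFourier_apply _ _).le)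
            exact ((mFourier (-n)).continuous.measurable.comp (measurable_displacement.comp
              measurable_prodMk_left)).aestronglyMeasurable
          simp only
          rw [integral_sub (integrable_const _) (hi.const_mul _), integral_const_mul,
            integral_const, Complex.ofReal_mul (c⁻¹ * t ^ (-1 - α / 2)), mul_assoc,
            exp_mul_integral_mFourier_displacement ht.le]
          simp only [probReal_univ, one_smul]
          push_cast
          ring
      _ = ((bracket n ^ α : ℝ) : ℂ) := by
          rw [integral_complex_ofReal, integral_const_mul,
            integral_one_sub_exp_mul_rpow (by positivity), rpow_bracket_sq, ← hcdef]
          rw [← mul_assoc, inv_mul_cancel₀ hc.ne', one_mul]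
  have main := abs_le_of_multiplier (ν := heatMeasure) (Y := displacement)
    (a := fun q => c⁻¹ * q.1 ^ (-1 - α / 2))
    (b := fun q => c⁻¹ * q.1 ^ (-1 - α / 2) * Real.exp (-q.1))
    (F := fun q => c⁻¹ * 3 * M * D q) (by fun_prop) (by fun_prop) measurable_displacement
    (by simp only [hD]; fun_prop) ((integrable_dominant hα hαβ).const_mul _) hJ hH
    (fun y => by
      filter_upwards [ae_heatMeasure_pos] with q hq
      have key := norm_sub_exp_smul_displacement_le (φ := J) (hα.trans hαβ) hβ hM hJh y hq q.2
      rw [Real.norm_eq_abs, smul_eq_mul] at key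
      have e : c⁻¹ * q.1 ^ (-1 - α / 2) * J y
          - c⁻¹ * q.1 ^ (-1 - α / 2) * Real.exp (-q.1) * J (y - displacement q)
          = c⁻¹ * q.1 ^ (-1 - α / 2)
            * (J y - Real.exp (-q.1) * J (y - displacement (q.1, q.2))) := by ring
      rw [e, abs_mul, abs_of_nonneg (by positivity)]
      calc _ ≤ _ := mul_le_mul_of_nonneg_left key (by positivity)
        _ = _ := by simp only [hD]; ring)
    (fun n => by rw [hmul, hcoeff]) y
  rw [integral_const_mul] at main
  linarith

/-- `⟨∇⟩^α` with `α < 0` is bounded on bounded functions. -/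
lemma exists_bound_of_bessel_neg {α : ℝ} (hα : α < 0) :
    ∃ C : ℝ, 0 ≤ C ∧ ∀ (J H : T3 → ℝ) (M : ℝ), Continuous J → Continuous H → (∀ y, |J y| ≤ M) →
      (∀ n, coeff H n = ((bracket n ^ α : ℝ) : ℂ) * coeff J n) → ∀ y, |H y| ≤ C * M := by
  have ha : 0 < -α / 2 := by linarith
  set c := Real.Gamma (-α / 2) with hcdef
  have hc : 0 < c := Real.Gamma_pos_of_pos ha
  set D : ℝ × (Fin 3 → ℝ) → ℝ := fun q =>
    (q.1 ^ (-α / 2 - 1) * Real.exp (-q.1)) * (fun _ => 1) q.2 with hD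
  have hDm : Measurable D := by simp only [hD]; fun_prop
  have hDi : Integrable D heatMeasure := by
    have h1 : IntegrableOn (fun t : ℝ => t ^ (-α / 2 - 1) * Real.exp (-t)) (Set.Ioi 0) := by
      have := Real.GammaIntegral_convergent ha
      simpa only [mul_comm] using this
    exact Integrable.mul_prod h1 (integrable_const (1 : ℝ))
  have hDpos : 0 ≤ ∫ q, D q ∂heatMeasure := by
    refine integral_nonneg_of_ae ?_
    filter_upwards [ae_heatMeasure_pos] with q hq
    simp only [hD, Pi.zero_apply]
    positivity
  refine ⟨c⁻¹ * ∫ q, D q ∂heatMeasure, by positivity, fun J H M hJ hH hM hcoeff y => ?_⟩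
  -- The Gamma integral for ⟨n⟩^α: a positive integrable weight on translations, so no cancellation
  -- and no Hölder bound is needed.
  have hmul : ∀ n : Fin 3 → ℤ, ∫ q : ℝ × (Fin 3 → ℝ), (((0 : ℝ) : ℂ)
      - ((-(c⁻¹ * D q) : ℝ) : ℂ) * mFourier (-n) (displacement q))
        ∂heatMeasure = ((bracket n ^ α : ℝ) : ℂ) := by
    intro n
    have hint : Integrable (fun q : ℝ × (Fin 3 → ℝ) => (((0 : ℝ) : ℂ)
      - ((-(c⁻¹ * D q) : ℝ) : ℂ) * mFourier (-n) (displacement q))) heatMeasure := by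
      refine (integrable_const_iff.mpr (Or.inl (by simp))).sub
        ((hDi.const_mul c⁻¹).neg.ofReal.mul_bdd (c := 1) ?_
          (.of_forall fun g => (norm_mFourier_apply _ _).le))
      exact ((mFourier (-n)).continuous.measurable.comp
        measurable_displacement).aestronglyMeasurable
    rw [integral_prod _ hint]
    have hr : 0 < 1 + ∑ i, (n i : ℝ) ^ 2 := by positivity
    calc _ = ∫ t in Set.Ioi (0 : ℝ), ((c⁻¹ * (t ^ (-α / 2 - 1)
          * Real.exp (-((1 + ∑ i, (n i : ℝ) ^ 2) * t))) : ℝ) : ℂ) := by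
          refine setIntegral_congr_fun measurableSet_Ioi fun t ht => ?_
          have ht : (0:ℝ) < t := ht
          have e : ∀ g, ((0 : ℝ) : ℂ)
              - ((-(c⁻¹ * D (t, g)) : ℝ) : ℂ) * mFourier (-n) (displacement (t, g))
              = ((c⁻¹ * t ^ (-α / 2 - 1) : ℝ) : ℂ)
                * ((Real.exp (-t) : ℂ) * mFourier (-n) (displacement (t, g))) := fun g => by
            simp only [hD]
            push_cast
            ring
          simp only [e]
          rw [integral_const_mul, integral_const_mul,
            exp_mul_integral_mFourier_displacement ht.le, mul_comm t]
          push_cast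
          ring
      _ = ((bracket n ^ α : ℝ) : ℂ) := by
          rw [integral_complex_ofReal, integral_const_mul,
            Real.integral_rpow_mul_exp_neg_mul_Ioi ha hr, ← hcdef, mul_comm _ c, ← mul_assoc,
            inv_mul_cancel₀ hc.ne', one_mul, one_div, Real.inv_rpow hr.le, ← Real.rpow_neg hr.le,
            ← rpow_bracket_sq]
          congr 2
          ring
  have main := abs_le_of_multiplier (ν := heatMeasure) (Y := displacement)
    (a := fun _ => 0) (b := fun q => -(c⁻¹ * D q))
    (F := fun q => c⁻¹ * M * D q) (by fun_prop) (by fun_prop) measurable_displacement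
    (by fun_prop) (hDi.const_mul _) hJ hH
    (fun y => by
      filter_upwards [ae_heatMeasure_pos] with q hq
      have hDq : 0 ≤ D q := by simp only [hD]; positivity
      rw [zero_mul, zero_sub, neg_mul, neg_neg, abs_mul, abs_of_nonneg (by positivity)]
      calc _ ≤ _ := mul_le_mul_of_nonneg_left (hM _) (by positivity)
        _ = _ := by ring)
    (fun n => by rw [hmul, hcoeff]) y
  rw [integral_const_mul] at main
  linarith

/-- `⟨∇⟩^α` with `α < β` maps bounded `β`-Hölder functions to bounded functions. -/
lemma exists_bound_of_bessel {α β : ℝ} (hαβ : α < β) (hβ : β ≤ 1) :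
    ∃ C : ℝ, 0 ≤ C ∧ ∀ (J H : T3 → ℝ) (M : ℝ), Continuous J → Continuous H → (∀ y, |J y| ≤ M) →
      (∀ y h, |J y - J (y - proj h)| ≤ M * ‖h‖ ^ β) →
      (∀ n, coeff H n = ((bracket n ^ α : ℝ) : ℂ) * coeff J n) → ∀ y, |H y| ≤ C * M := by
  rcases lt_trichotomy α 0 with hα | hα | hα
  · obtain ⟨C, hC, h⟩ := exists_bound_of_bessel_neg hα
    exact ⟨C, hC, fun J H M hJ hH hM _ hc => h J H M hJ hH hM hc⟩
  -- For α = 0 the coefficients agree, and a one-point average with a = 1, b = 0 turns this into a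
  -- pointwise bound.
  · refine ⟨1, zero_le_one, fun J H M hJ hH hM _ hc y => ?_⟩
    have := abs_le_of_multiplier (ν := Measure.dirac ()) (a := fun _ => 1) (b := fun _ => 0)
      (Y := fun _ => 0) (F := fun _ => M) (by fun_prop) (by fun_prop) (by fun_prop) (by fun_prop)
      (integrable_const _) hJ hH (fun y => by simpa using hM y)
      (fun n => by simp [hc, hα]) y
    simpa using this
  · exact exists_bound_of_bessel_pos hα hαβ hβ

/-! ### Pointwise increments of the nonlinearity -/

/-- Bernoulli's inequality at y/x. The extra factor y ≤ x cancels the division by x, so the exponent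
q - 1 never appears. -/
lemma rpow_sub_rpow_mul_le {q x y : ℝ} (hq : 1 ≤ q) (hy : 0 ≤ y) (hyx : y ≤ x) :
    (x ^ q - y ^ q) * y ≤ q * x ^ q * (x - y) := by
  rcases (hy.trans hyx).eq_or_lt with hx | hx
  · have : y = 0 := le_antisymm (hx ▸ hyx) hy
    simp [← hx, this]
  · have h1 := one_add_mul_self_le_rpow_one_add (s := y / x - 1)
      (by linarith [div_nonneg hy hx.le]) hq
    rw [add_sub_cancel, Real.div_rpow hy hx.le, le_div_iff₀ (by positivity)] at h1
    have hxq : 0 < x ^ q := by positivity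
    have h2 : x ^ q - y ^ q ≤ q * x ^ q * (1 - y / x) := by nlinarith
    have h3 : 0 ≤ q * x ^ q * (1 - y / x) := by
      have : y / x ≤ 1 := (div_le_one hx).mpr hyx
      have : 0 ≤ 1 - y / x := by linarith
      positivity
    calc (x ^ q - y ^ q) * y ≤ q * x ^ q * (1 - y / x) * y := by gcongr
      _ ≤ q * x ^ q * (1 - y / x) * x := by gcongr
      _ = q * x ^ q * (x - y) := by field_simp

lemma abs_rpow_mul_sub_le {q a b : ℝ} (hq : 1 ≤ q) :
    |(|a| ^ q * a - |b| ^ q * b)| ≤ (q + 1) * (|a| + |b|) ^ q * |a - b| := by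
  wlog hab : |b| ≤ |a| generalizing a b
  · have := this (a := b) (b := a) (le_of_not_ge hab)
    rwa [abs_sub_comm, add_comm |b|, abs_sub_comm b a] at this
  have e : |a| ^ q * a - |b| ^ q * b = |a| ^ q * (a - b) + (|a| ^ q - |b| ^ q) * b := by ring
  have h0 : 0 ≤ |a| ^ q - |b| ^ q := sub_nonneg.mpr (by gcongr)
  have hW : |a| ^ q ≤ (|a| + |b|) ^ q := by gcongr; linarith [abs_nonneg b]
  calc _ ≤ |a| ^ q * |a - b| + (|a| ^ q - |b| ^ q) * |b| := by
        rw [e]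
        refine (abs_add_le _ _).trans (le_of_eq ?_)
        rw [abs_mul, abs_mul, abs_of_nonneg h0, abs_of_nonneg (by positivity)]
    _ ≤ |a| ^ q * |a - b| + q * |a| ^ q * |a - b| := by
        refine add_le_add_right ((rpow_sub_rpow_mul_le hq (abs_nonneg b) hab).trans ?_) _
        gcongr
        exact abs_sub_abs_le_abs_sub a b
    _ = (q + 1) * |a| ^ q * |a - b| := by ring
    _ ≤ _ := by gcongr

/-- The pointwise interpolation inequality behind the smoothing of `|v|^{p-1} v`. -/
lemma abs_rpow_mul_sub_le_interpolation {p a b r : ℝ} (hp : 3 < p) (hr : 0 < r) :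
    |(|a| ^ (p - 1) * a - |b| ^ (p - 1) * b)|
      ≤ p * r ^ (2 / (p - 1))
        * (2 ^ (p + 1) * (|a| ^ (p + 1) + |b| ^ (p + 1)) + (a - b) ^ 2 / r ^ 2) := by
  have hp1 : 0 < p - 1 := by linarith
  set β := 2 / (p - 1) with hβ
  have hβ0 : 0 < β := by positivity
  have hβ1 : β < 1 := by rw [hβ, div_lt_one hp1]; linarith
  set W := |a| + |b| with hW
  set u := |a - b| with hu
  have hW0 : 0 ≤ W := by positivity
  have hu0 : 0 ≤ u := abs_nonneg _
  have huW : u ≤ W := abs_sub a b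
  have h1 : |(|a| ^ (p - 1) * a - |b| ^ (p - 1) * b)| ≤ p * W ^ (p - 1) * u := by
    have := abs_rpow_mul_sub_le (a := a) (b := b) (by linarith : 1 ≤ p - 1)
    rwa [sub_add_cancel] at this
  have h2 : u ≤ u ^ β * W ^ (1 - β) := by
    calc u = u ^ β * u ^ (1 - β) := by
          rw [← Real.rpow_add_of_nonneg hu0 hβ0.le (by linarith), add_sub_cancel, Real.rpow_one]
      _ ≤ _ := by gcongr
  -- The choice β = 2/(p-1) is the one for which W^{p-β} u^β is the geometric mean of W^{p+1} and u²
  -- with weights 1 - β/2 and β/2.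
  have h3 : W ^ (p - 1) * (u ^ β * W ^ (1 - β))
      = r ^ β * ((W ^ (p + 1)) ^ (1 - β / 2) * ((u / r) ^ 2) ^ (β / 2)) := by
    rw [← Real.rpow_mul hW0, ← Real.rpow_natCast, ← Real.rpow_mul (by positivity),
      Real.div_rpow hu0 hr.le]
    have e1 : ((2 : ℕ) : ℝ) * (β / 2) = β := by push_cast; ring
    have e2 : (p + 1) * (1 - β / 2) = (p - 1) + (1 - β) := by
      rw [hβ]; field_simp; ring
    rw [e1, e2, Real.rpow_add_of_nonneg hW0 hp1.le (by linarith)]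
    have : r ^ β ≠ 0 := by positivity
    field_simp
  have h4 : (W ^ (p + 1)) ^ (1 - β / 2) * ((u / r) ^ 2) ^ (β / 2) ≤ W ^ (p + 1) + (u / r) ^ 2 := by
    refine (Real.geom_mean_le_arith_mean2_weighted (by linarith) (by linarith) (by positivity)
      (by positivity) (by ring)).trans ?_
    gcongr
    · exact mul_le_of_le_one_left (by positivity) (by linarith)
    · exact mul_le_of_le_one_left (by positivity) (by linarith)
  have h5 : W ^ (p + 1) ≤ 2 ^ (p + 1) * (|a| ^ (p + 1) + |b| ^ (p + 1)) := by
    calc W ^ (p + 1) ≤ (2 * max |a| |b|) ^ (p + 1) := by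
          gcongr
          linarith [le_max_left |a| |b|, le_max_right |a| |b|]
      _ = 2 ^ (p + 1) * (max |a| |b|) ^ (p + 1) := Real.mul_rpow (by norm_num) (by positivity)
      _ ≤ _ := by
          gcongr
          rcases max_choice |a| |b| with h | h <;> rw [h]
          · linarith [Real.rpow_nonneg (abs_nonneg b) (p + 1)]
          · linarith [Real.rpow_nonneg (abs_nonneg a) (p + 1)]
  have h6 : (u / r) ^ 2 = (a - b) ^ 2 / r ^ 2 := by rw [div_pow, hu, sq_abs]
  calc _ ≤ p * W ^ (p - 1) * u := h1
    _ ≤ p * W ^ (p - 1) * (u ^ β * W ^ (1 - β)) := by gcongr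
    _ = p * (W ^ (p - 1) * (u ^ β * W ^ (1 - β))) := by ring
    _ ≤ p * (r ^ β * (W ^ (p + 1) + (u / r) ^ 2)) := by rw [h3]; gcongr
    _ ≤ p * (r ^ β * (2 ^ (p + 1) * (|a| ^ (p + 1) + |b| ^ (p + 1)) + (a - b) ^ 2 / r ^ 2)) := by
        rw [h6]; gcongr
    _ = _ := by ring

/-! ### Consequences of finite energy -/

variable {p : ℝ} {v vt : T3 → ℝ} {gradv : Fin 3 → T3 → ℝ}

lemma FiniteEnergy.integrable_rpow (hE : FiniteEnergy p v vt gradv) (hp : 3 < p) :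
    Integrable (fun θ => |v θ| ^ (p + 1)) haar := by
  have h := hE.memLp.integrable_norm_rpow (by simp; linarith) ENNReal.ofReal_ne_top
  simpa [ENNReal.toReal_ofReal (by linarith : 0 ≤ p + 1)] using h

lemma FiniteEnergy.memLp_two (hE : FiniteEnergy p v vt gradv) (hp : 3 < p) : MemLp v 2 haar := by
  refine hE.memLp.mono_exponent ?_
  rw [← ENNReal.ofReal_ofNat]
  exact ENNReal.ofReal_le_ofReal (by linarith)

/-- The energy controls the potential and the gradient terms. -/
lemma FiniteEnergy.integral_add_integral_le (hE : FiniteEnergy p v vt gradv) (hp : 3 < p) :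
    ∫ θ, |v θ| ^ (p + 1) ∂haar + ∫ θ, ∑ i, gradv i θ ^ 2 ∂haar ≤ (p + 1) * energy p v vt gradv := by
  have h1 := hE.integrable_rpow hp
  have h2 : Integrable (fun θ => ∑ i, gradv i θ ^ 2) haar :=
    integrable_finsetSum _ fun i _ => (hE.memLp_grad i).integrable_sq
  have h3 : Integrable (fun θ => vt θ ^ 2 / 2) haar := hE.memLp_dt.integrable_sq.div_const 2
  have hi : Integrable (fun θ => vt θ ^ 2 / 2 + (∑ i, gradv i θ ^ 2) / 2
      + |v θ| ^ (p + 1) / (p + 1)) haar := (h3.add (h2.div_const 2)).add (h1.div_const _)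
  rw [← integral_add h1 h2, energy, integral]
  have hle : ∫ θ, |v θ| ^ (p + 1) + ∑ i, gradv i θ ^ 2 ∂haar
      ≤ (p + 1) * ∫ θ, vt θ ^ 2 / 2 + (∑ i, gradv i θ ^ 2) / 2 + |v θ| ^ (p + 1) / (p + 1) ∂haar := by
    rw [← integral_const_mul]
    refine integral_mono (h1.add h2) (hi.const_mul _) fun θ => ?_
    have : 0 ≤ ∑ i, gradv i θ ^ 2 := by positivity
    have e : (p + 1) * (|v θ| ^ (p + 1) / (p + 1)) = |v θ| ^ (p + 1) := by field_simp
    simp only [mul_add]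
    rw [e]
    nlinarith [sq_nonneg (vt θ)]
  have hnn : 0 ≤ ∫ θ, vt θ ^ 2 / 2 + (∑ i, gradv i θ ^ 2) / 2
      + |v θ| ^ (p + 1) / (p + 1) ∂haar := integral_nonneg fun θ => by positivity
  have hpi : 1 ≤ (2 * Real.pi) ^ 3 := one_le_pow₀ (by linarith [Real.pi_gt_three])
  calc _ ≤ _ := hle
    _ ≤ _ := by gcongr; exact le_mul_of_one_le_left hnn hpi

/-- The nonlinearity has `L¹` modulus of continuity `|h|^{2/(p-1)}`, controlled by the energy. -/
lemma FiniteEnergy.integral_abs_sub_translate_le (hE : FiniteEnergy p v vt gradv) (hp : 3 < p)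
    (hf : Integrable (fun θ => |v θ| ^ (p - 1) * v θ) haar) (h : Fin 3 → ℝ) :
    ∫ θ, |(|v θ| ^ (p - 1) * v θ - |v (θ - proj h)| ^ (p - 1) * v (θ - proj h))| ∂haar
      ≤ p * (2 ^ (p + 2) + 12 * Real.pi ^ 2) * ((p + 1) * energy p v vt gradv)
        * ‖h‖ ^ (2 / (p - 1)) := by
  have hp1 : 0 < p - 1 := by linarith
  have hβ0 : 0 < 2 / (p - 1) := by positivity
  rcases (norm_nonneg h).eq_or_lt with h0 | hr
  · have hz : proj h = 0 := by
      have : h = 0 := norm_eq_zero.mp h0.symm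
      ext i
      simp [proj, this]
    simp [hz, ← h0, Real.zero_rpow hβ0.ne']
  have hv2 := hE.memLp_two hp
  have hI := hE.integrable_rpow hp
  have hI' : Integrable (fun θ => |v (θ - proj h)| ^ (p + 1)) haar :=
    (measurePreserving_sub (proj h)).integrable_comp_of_integrable hI
  have hf' : Integrable (fun θ => |v (θ - proj h)| ^ (p - 1) * v (θ - proj h)) haar :=
    (measurePreserving_sub (proj h)).integrable_comp_of_integrable hf
  have hd : Integrable (fun θ => (v θ - v (θ - proj h)) ^ 2) haar :=
    (hv2.sub (hv2.comp_measurePreserving (measurePreserving_sub (proj h)))).integrable_sq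
  have hsum := hE.integral_add_integral_le hp
  have htr : ∫ θ, |v (θ - proj h)| ^ (p + 1) ∂haar = ∫ θ, |v θ| ^ (p + 1) ∂haar :=
    integral_sub_right_eq_self (fun θ => |v θ| ^ (p + 1)) (proj h)
  have hL2 := integral_sq_sub_translate_le hv2 hE.isWeakGradient hE.memLp_grad h
  set A := ∫ θ, |v θ| ^ (p + 1) ∂haar
  set B := ∫ θ, ∑ i, gradv i θ ^ 2 ∂haar
  have hA : 0 ≤ A := integral_nonneg fun θ => by positivity
  have hB : 0 ≤ B := integral_nonneg fun θ => by positivity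
  have h2p : (2 : ℝ) ^ (p + 2) = 2 * 2 ^ (p + 1) := by
    rw [show p + 2 = 1 + (p + 1) by ring, Real.rpow_add (by norm_num), Real.rpow_one]
  -- With the free scale r = ‖h‖, the squared increment divided by r² integrates to O(1) times the
  -- gradient term, leaving r^β as the only power of ‖h‖.
  calc _ ≤ ∫ θ, p * ‖h‖ ^ (2 / (p - 1)) * (2 ^ (p + 1) * (|v θ| ^ (p + 1)
          + |v (θ - proj h)| ^ (p + 1)) + (v θ - v (θ - proj h)) ^ 2 / ‖h‖ ^ 2) ∂haar :=
        integral_mono (hf.sub hf').abs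
          ((((hI.add hI').const_mul _).add (hd.div_const _)).const_mul _)
          fun θ => abs_rpow_mul_sub_le_interpolation hp hr
    _ = p * ‖h‖ ^ (2 / (p - 1)) * (2 ^ (p + 1) * (A + A)
          + (∫ θ, (v θ - v (θ - proj h)) ^ 2 ∂haar) / ‖h‖ ^ 2) := by
        have hII : Integrable (fun θ => |v θ| ^ (p + 1) + |v (θ - proj h)| ^ (p + 1)) haar :=
          hI.add hI'
        rw [integral_const_mul, integral_add (hII.const_mul _) (hd.div_const _),
          integral_const_mul, integral_div, integral_add hI hI', htr]
    _ ≤ p * ‖h‖ ^ (2 / (p - 1)) * (2 ^ (p + 1) * (A + A) + 12 * Real.pi ^ 2 * B) := by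
        gcongr
        rw [div_le_iff₀ (by positivity)]
        linarith
    _ ≤ p * ‖h‖ ^ (2 / (p - 1)) * ((2 ^ (p + 2) + 12 * Real.pi ^ 2) * (A + B)) := by
        gcongr
        rw [h2p]
        have : (0:ℝ) < 2 ^ (p + 1) := by positivity
        nlinarith [mul_nonneg this.le hB, mul_nonneg (sq_nonneg Real.pi) hA]
    _ ≤ p * ‖h‖ ^ (2 / (p - 1)) * ((2 ^ (p + 2) + 12 * Real.pi ^ 2)
          * ((p + 1) * energy p v vt gradv)) := by gcongr
    _ = _ := by ring

end WaveTorus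

/-! ### The energy estimate -/

theorem mainTheorem6 (p s δ : ℝ) (hp₃ : 3 < p) (hp₅ : p < 5) (hδ : 0 < δ)
    (hs : (p - 3) / (p - 1) < s - δ) :
    ∃ C : ℝ, 0 < C ∧
      ∀ (v vt : WaveTorus.T3 → ℝ) (gradv : Fin 3 → WaveTorus.T3 → ℝ)
        (zt Ds_zt D_zt : WaveTorus.T3 → ℝ),
        WaveTorus.FiniteEnergy p v vt gradv →
        WaveTorus.IsBessel (s - δ) zt Ds_zt →
        MemLp Ds_zt ∞ WaveTorus.haar →
        WaveTorus.IsBessel 1 zt D_zt →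
        MemLp D_zt (ENNReal.ofReal (p + 1)) WaveTorus.haar →
        |WaveTorus.integral fun θ => |v θ| ^ (p - 1) * v θ * D_zt θ| ≤
          C * ((WaveTorus.normLinf Ds_zt + 1) * WaveTorus.energy p v vt gradv +
            WaveTorus.normLinf Ds_zt ^ (p + 1)) := by
  have hp1 : 0 < p - 1 := by linarith
  have hαβ : 1 - (s - δ) < 2 / (p - 1) := by
    have : (p - 3) / (p - 1) = 1 - 2 / (p - 1) := by field_simp; ring
    linarith
  obtain ⟨C, hC, hbound⟩ := WaveTorus.exists_bound_of_bessel hαβ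
    (by rw [div_le_one hp1]; linarith : 2 / (p - 1) ≤ 1)
  set K := p * (2 ^ (p + 2) + 12 * Real.pi ^ 2) * (p + 1) with hK
  have hK0 : 0 < K := by positivity
  refine ⟨(2 * Real.pi) ^ 3 * (C + 1) * (K + p + 2), by positivity,
    fun v vt gradv zt Ds_zt D_zt hE hDs hDsL hD hDL => ?_⟩
  have hI := hE.integrable_rpow hp₃
  have hsum := hE.integral_add_integral_le hp₃
  set f : WaveTorus.T3 → ℝ := fun θ => |v θ| ^ (p - 1) * v θ with hf
  set N := WaveTorus.normLinf Ds_zt with hN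
  have hN0 : 0 ≤ N := ENNReal.toReal_nonneg
  set E := WaveTorus.energy p v vt gradv with hEdef
  have hB : 0 ≤ ∫ θ, ∑ i, gradv i θ ^ 2 ∂WaveTorus.haar := integral_nonneg fun θ => by positivity
  have hA : 0 ≤ ∫ θ, |v θ| ^ (p + 1) ∂WaveTorus.haar := integral_nonneg fun θ => by positivity
  have hE0 : 0 ≤ E := by
    by_contra hneg
    nlinarith
  have hfabs : ∀ θ, |f θ| = |v θ| ^ p := fun θ => by
    simp only [hf]
    rw [abs_mul, abs_of_nonneg (Real.rpow_nonneg (abs_nonneg _) _)]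
    nth_rw 2 [← Real.rpow_one |v θ|]
    rw [← Real.rpow_add_of_nonneg (abs_nonneg _) hp1.le zero_le_one, sub_add_cancel]
  have hvm := hE.memLp.aestronglyMeasurable
  have hfm : AEStronglyMeasurable f WaveTorus.haar :=
    ((hvm.aemeasurable.abs.pow_const (p - 1)).mul hvm.aemeasurable).aestronglyMeasurable
  have hconj : ((p + 1) / p).HolderConjugate (p + 1) := by
    rw [Real.holderConjugate_comm, Real.holderConjugate_iff_eq_conjExponent (by linarith)]
    ring
  have hPQ : (ENNReal.ofReal ((p + 1) / p)).HolderConjugate (ENNReal.ofReal (p + 1)) :=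
    hconj.ennrealOfReal
  -- Because |f| = |v|^p, this is the integrability of |v|^{p+1}; the exponent is dual to that of
  -- `D_zt`.
  have hfP : MemLp f (ENNReal.ofReal ((p + 1) / p)) WaveTorus.haar := by
    rw [← integrable_norm_rpow_iff hfm (by simp; positivity) ENNReal.ofReal_ne_top,
      ENNReal.toReal_ofReal (by positivity)]
    refine hI.congr (.of_forall fun θ => ?_)
    simp only [Real.norm_eq_abs]
    rw [hfabs, ← Real.rpow_mul (abs_nonneg _)]
    congr 1
    field_simp
  have hfi : Integrable f WaveTorus.haar :=
    hfP.integrable (by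
      rw [← ENNReal.ofReal_one]
      exact ENNReal.ofReal_le_ofReal (by rw [le_div_iff₀ (by linarith)]; linarith))
  have hDsb : ∀ᵐ θ ∂WaveTorus.haar, |Ds_zt θ| ≤ N := by
    have := ae_le_eLpNormEssSup (f := Ds_zt) (μ := WaveTorus.haar)
    filter_upwards [this] with θ hθ
    rw [hN, WaveTorus.normLinf, ← Real.norm_eq_abs, ← toReal_enorm]
    exact ENNReal.toReal_mono hDsL.eLpNorm_ne_top (by rwa [eLpNorm_exponent_top])
  -- `continuous_corr` needs a finite exponent, so boundedness is weakened here.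
  have hDsQ : MemLp Ds_zt (ENNReal.ofReal (p + 1)) WaveTorus.haar := hDsL.mono_exponent le_top
  set J := WaveTorus.corr f Ds_zt with hJ
  set H := WaveTorus.corr f D_zt with hH
  have hJc : Continuous J := WaveTorus.continuous_corr ENNReal.ofReal_ne_top hfP hDsQ
  have hHc : Continuous H := WaveTorus.continuous_corr ENNReal.ofReal_ne_top hfP hDL
  set L := ∫ θ, |f θ| ∂WaveTorus.haar with hL
  have hL0 : 0 ≤ L := integral_nonneg fun θ => abs_nonneg _
  have hcoeff : ∀ n, WaveTorus.coeff H n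
      = ((WaveTorus.bracket n ^ (1 - (s - δ)) : ℝ) : ℂ) * WaveTorus.coeff J n := fun n => by
    have hbr : WaveTorus.bracket (-n) = WaveTorus.bracket n := by simp [WaveTorus.bracket]
    have e : WaveTorus.bracket n ^ (1 : ℝ)
        = WaveTorus.bracket n ^ (1 - (s - δ)) * WaveTorus.bracket n ^ (s - δ) := by
      rw [← Real.rpow_add (WaveTorus.bracket_pos n), sub_add_cancel]
    rw [hH, hJ, WaveTorus.coeff_corr hfi hD.integrable_right,
      WaveTorus.coeff_corr hfi hDs.integrable_right, hD.coeff_eq, hDs.coeff_eq, hbr, e,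
      Complex.ofReal_mul]
    ring
  -- N L bounds J and N K E is its Hölder constant; the sum serves as the common M.
  have hmain := hbound J H (N * (L + K * E)) hJc hHc
    (fun y => (WaveTorus.abs_corr_le hfi hDsb y).trans (by gcongr; nlinarith))
    (fun y h => by
      refine (WaveTorus.abs_corr_sub_le hfi hDsL.aestronglyMeasurable hDsb y _).trans ?_
      rw [mul_assoc]
      gcongr
      refine (hE.integral_abs_sub_translate_le hp₃ hfi h).trans ?_
      gcongr
      rw [hK]
      linarith) hcoeff 0
  -- Pointwise, N|v|^p is at most the (p+1)-th power of the larger of N and |v|; the measure has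
  -- total mass one.
  have hyoung : N * L ≤ (p + 1) * E + N ^ (p + 1) := by
    have : N * L ≤ ∫ θ, (|v θ| ^ (p + 1) + N ^ (p + 1)) ∂WaveTorus.haar := by
      rw [hL, ← integral_const_mul]
      refine integral_mono (hfi.abs.const_mul N) (hI.add (integrable_const _)) fun θ => ?_
      simp only
      rw [hfabs]
      have hx := abs_nonneg (v θ)
      have split : ∀ x : ℝ, 0 ≤ x → x ^ (p + 1) = x * x ^ p := fun x hx => by
        rw [Real.rpow_add_of_nonneg hx (by linarith) zero_le_one, Real.rpow_one, mul_comm]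
      rcases le_total N |v θ| with h | h
      · calc N * |v θ| ^ p ≤ |v θ| * |v θ| ^ p := by gcongr
          _ = |v θ| ^ (p + 1) := (split _ hx).symm
          _ ≤ _ := le_add_of_nonneg_right (by positivity)
      · calc N * |v θ| ^ p ≤ N * N ^ p := by gcongr
          _ = N ^ (p + 1) := (split _ hN0).symm
          _ ≤ _ := le_add_of_nonneg_left (by positivity)
    rw [integral_add hI (integrable_const _), integral_const, probReal_univ, one_smul] at this
    linarith
  have hH0 : WaveTorus.integral (fun θ => |v θ| ^ (p - 1) * v θ * D_zt θ)
      = (2 * Real.pi) ^ 3 * H 0 := by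
    simp [WaveTorus.integral, hH, WaveTorus.corr, hf]
  rw [hH0, abs_mul, abs_of_pos (by positivity)]
  have hNp : 0 ≤ N ^ (p + 1) := by positivity
  have hfin : N * (L + K * E) ≤ (K + p + 2) * ((N + 1) * E + N ^ (p + 1)) := by
    have h1 : 0 ≤ N * E := by positivity
    nlinarith [mul_nonneg hK0.le hE0, mul_nonneg hK0.le hNp]
  calc (2 * Real.pi) ^ 3 * |H 0| ≤ (2 * Real.pi) ^ 3 * (C * (N * (L + K * E))) := by gcongr
    _ ≤ (2 * Real.pi) ^ 3 * ((C + 1) * ((K + p + 2) * ((N + 1) * E + N ^ (p + 1)))) := by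
        gcongr
        linarith
    _ = _ := by ring
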